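/- Let $G$ be a finite group of composite order (that is, $|G|>1$ and $|G|$ is not prime). For an inverse-closed subset $S$ of $G\setminus\{e\}$, where $e$ is the identity of $G$, the Cayley graph $\mathrm{Cay}(G,S)$ is the simple graph with vertex set $G$ in which $x$ and $y$ are adjacent if and only if $yx^{-1}\in S$. A subset $C\subseteq G$ is called a perfect code of $G$ if for some such $S$, every vertex of $\mathrm{Cay}(G,S)$ is at distance at most $1$ from exactly one vertex of $C$. A generalized quaternion group is a group of order $4n$, for some integer $n\geqslant 2$, with presentation $\langle a,b\mid a^{2n}=e,\ b^2=a^n,\ b^{-1}ab=a^{-1}\rangle$. Then the following three conditions are equivalent: (a) no subgroup $H$ of $G$ with $\{e\}\neq H\neq G$ is a perfect code of $G$; (b) $G$ is a $2$-group with a unique involution, that is, with exactly one element of order $2$; (c) $G$ is either a cyclic $2$-group or a generalized quaternion $2$-group (a $2$-group that is a generalized quaternion group). -/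

import Mathlib

/-- A set `C` of vertices is a perfect code in the graph `Γ` if every vertex of `Γ` is at distance
at most `1` from exactly one vertex of `C`. The distance is the extended one, so that vertices
in different components are at distance `⊤`. -/
def SimpleGraph.IsPerfectCode {V : Type*} (Γ : SimpleGraph V) (C : Set V) : Prop :=
  ∀ v : V, ∃! c : V, c ∈ C ∧ Γ.edist v c ≤ 1

/-- The Cayley graph on `G` with connection set `S`, an inverse-closed set of non-identity
elements: `x` and `y` are adjacent if and only if `y * x⁻¹ ∈ S`. -/
def cayleyGraph {G : Type*} [Group G] (S : Set G) (h_one : (1 : G) ∉ S)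
    (h_inv : ∀ s ∈ S, s⁻¹ ∈ S) : SimpleGraph G where
  Adj x y := y * x⁻¹ ∈ S
  symm := ⟨fun x y h => by simpa using h_inv _ h⟩
  loopless := ⟨fun x h => h_one (by simpa using h)⟩

/-- A subset `C` of a group `G` is a perfect code of `G` if it is a perfect code in some Cayley
graph of `G`. -/
def IsGroupPerfectCode {G : Type*} [Group G] (C : Set G) : Prop :=
  ∃ (S : Set G) (h_one : (1 : G) ∉ S) (h_inv : ∀ s ∈ S, s⁻¹ ∈ S),
    (cayleyGraph S h_one h_inv).IsPerfectCode C

/-- A generalized quaternion group: for some `n ≥ 2`, the group of order `4 * n` with presentation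
`⟨a, b ∣ a ^ (2 * n) = 1, b ^ 2 = a ^ n, b⁻¹ * a * b = a⁻¹⟩`. -/
def IsGeneralizedQuaternion (G : Type*) [Group G] : Prop :=
  ∃ n : ℕ, 2 ≤ n ∧ Nonempty (G ≃* QuaternionGroup n)

/-! A subgroup `H` is a perfect code iff the left cosets other than `H` have an inverse-closed set
of representatives. Inversion links every left coset in `HxH` with every left coset in `Hx⁻¹H`, and
both double cosets contain equally many. So representatives can be chosen in pairs, except that a
self-inverse `HxH` with an odd number of left cosets needs a representative equal to its inverse
(`isGroupPerfectCode_of_forall_odd`).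

(a) ⇒ (b): subgroups of odd prime order are perfect codes, so `G` is a 2-group. If `z ≠ t` were
involutions, a subgroup containing `z` and maximal among those avoiding `t` would be one too. (b) ⇒
(a): in a 2-group some `x ∉ H` normalizes `H` with `x² ∈ H`; the representative of `xH` would be an
involution outside `H`, whereas `H` contains the only one. (b) ⇒ (c): a maximal normal cyclic `⟨a⟩`
is its own centralizer. Every element outside it inverts `a` and squares to the involution, so `⟨a⟩`
has index at most 2. (c) ⇒ (b): involutions are counted directly. -/

theorem SimpleGraph.edist_le_one_iff' {V : Type*} (Γ : SimpleGraph V) (u v : V) :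
    Γ.edist u v ≤ 1 ↔ u = v ∨ Γ.Adj u v := by
  rw [Order.le_one_iff]
  simp [SimpleGraph.edist_eq_one_iff_adj]

/-! ### Perfect codes as inverse-closed transversals -/

section PerfectCode

variable {G : Type*} [Group G] {H : Subgroup G}

theorem cayleyGraph_edist_le_one_iff {S : Set G} (h_one : (1 : G) ∉ S)
    (h_inv : ∀ s ∈ S, s⁻¹ ∈ S) (v c : G) :
    (cayleyGraph S h_one h_inv).edist v c ≤ 1 ↔ v = c ∨ c * v⁻¹ ∈ S :=
  SimpleGraph.edist_le_one_iff' _ v c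

/-- An inverse-closed set of representatives of the nontrivial left cosets of a subgroup
is a connection set for which the subgroup is a perfect code. -/
theorem isGroupPerfectCode_of_transversal {S : Set G} (h_inv : ∀ s ∈ S, s⁻¹ ∈ S)
    (h_disj : ∀ s ∈ S, s ∉ H) (h_cover : ∀ x ∉ H, ∃! s, s ∈ S ∧ x⁻¹ * s ∈ H) :
    IsGroupPerfectCode (H : Set G) := by
  refine ⟨S, fun h => h_disj 1 h H.one_mem, h_inv, fun v => ?_⟩
  simp only [cayleyGraph_edist_le_one_iff, SetLike.mem_coe]
  by_cases hv : v ∈ H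
  · refine ⟨v, ⟨hv, Or.inl rfl⟩, ?_⟩
    rintro c ⟨hc, rfl | h⟩
    · rfl
    · exact absurd (H.mul_mem hc (H.inv_mem hv)) (h_disj _ h)
  · obtain ⟨s, ⟨hs, hsv⟩, huniq⟩ := h_cover v hv
    -- Neighbours `c ∈ H` of `v` correspond to elements `s = v * c⁻¹` of `S` in the coset `vH`.
    refine ⟨s⁻¹ * v, ⟨by simpa using H.inv_mem hsv, Or.inr (by simpa using h_inv s hs)⟩, ?_⟩
    rintro c ⟨hc, rfl | h⟩
    · exact absurd hc hv
    · have := huniq (c * v⁻¹)⁻¹ ⟨h_inv _ h, by simpa using H.inv_mem hc⟩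
      rw [← this]
      group

/-- Every coset of a perfect code `H` other than `H` contains an element of the connection set,
and each left coset contains at most one. -/
theorem exists_transversal_of_isGroupPerfectCode (h : IsGroupPerfectCode (H : Set G)) :
    ∃ S : Set G, (∀ s ∈ S, s⁻¹ ∈ S) ∧ ∀ x ∉ H, ∃! s, s ∈ S ∧ x⁻¹ * s ∈ H := by
  obtain ⟨S, h_one, h_inv, hS⟩ := h
  refine ⟨S, h_inv, fun x hx => ?_⟩
  obtain ⟨c, ⟨hc, hxc⟩, huniq⟩ := hS x
  simp only [cayleyGraph_edist_le_one_iff, SetLike.mem_coe] at hc hxc huniq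
  rcases hxc with rfl | hxc
  · exact absurd hc hx
  refine ⟨(c * x⁻¹)⁻¹, ⟨h_inv _ hxc, by simpa using hc⟩, ?_⟩
  rintro s ⟨hs, hxs⟩
  have := huniq (s⁻¹ * x) ⟨by simpa using H.inv_mem hxs, Or.inr (by simpa using h_inv s hs)⟩
  rw [← this]
  group

/-! ### Linked cosets and the choice of representatives -/

/-- Two left cosets are linked if they contain mutually inverse elements. -/
def CosetLink (H : Subgroup G) (q r : G ⧸ H) : Prop :=
  ∃ a : G, (a : G ⧸ H) = q ∧ ((a⁻¹ : G) : G ⧸ H) = r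

theorem CosetLink.symm {q r : G ⧸ H} (h : CosetLink H q r) : CosetLink H r q := by
  obtain ⟨a, ha, hb⟩ := h
  exact ⟨a⁻¹, hb, by simpa using ha⟩

theorem exists_cosetLink (q : G ⧸ H) : ∃ r, CosetLink H q r := by
  obtain ⟨a, rfl⟩ := QuotientGroup.mk_surjective q
  exact ⟨_, a, rfl, rfl⟩

/-- The inverses of the elements of `aH` form `Ha⁻¹`, which meets exactly the left cosets in
`Ha⁻¹H`. -/
theorem cosetLink_mk_inv_iff {a : G} {r : G ⧸ H} :
    CosetLink H a r ↔ r ∈ MulAction.orbit H ((a⁻¹ : G) : G ⧸ H) := by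
  constructor
  · rintro ⟨b, hb, rfl⟩
    refine ⟨⟨b⁻¹ * a, QuotientGroup.eq.1 hb⟩, ?_⟩
    change ((b⁻¹ * a * a⁻¹ : G) : G ⧸ H) = _
    simp
  · rintro ⟨⟨h, hh⟩, rfl⟩
    refine ⟨a * h⁻¹, QuotientGroup.eq.2 (by simpa using hh), ?_⟩
    change _ = ((h * a⁻¹ : G) : G ⧸ H)
    simp

theorem CosetLink.difunctional {p q r s : G ⧸ H} (hqr : CosetLink H q r)
    (hpr : CosetLink H p r) (hps : CosetLink H p s) : CosetLink H q s := by
  obtain ⟨a, rfl, rfl⟩ := hqr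
  obtain ⟨b, rfl⟩ := QuotientGroup.mk_surjective p
  rw [cosetLink_mk_inv_iff] at hpr hps ⊢
  rw [MulAction.orbit_eq_iff.2 hpr]
  exact hps

/-- By orbit-stabilizer it suffices to compare the stabilizers of `aH` and `a⁻¹H`, which are
conjugate by `a`. -/
theorem CosetLink.card_eq [Finite G] {q r : G ⧸ H} (h : CosetLink H q r) :
    Nat.card {s // CosetLink H q s} = Nat.card {s // CosetLink H r s} := by
  obtain ⟨a, rfl, rfl⟩ := h
  have key (b : G) : Nat.card {s // CosetLink H (b : G ⧸ H) s} *
      Nat.card (MulAction.stabilizer H ((b⁻¹ : G) : G ⧸ H)) = Nat.card H := by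
    rw [← Nat.card_congr (MulAction.orbitProdStabilizerEquivGroup H ((b⁻¹ : G) : G ⧸ H)),
      Nat.card_prod]
    congr 1
    exact Nat.card_congr (Equiv.subtypeEquivRight fun s => cosetLink_mk_inv_iff)
  have mem (b : G) (h : H) : h ∈ MulAction.stabilizer H (b : G ⧸ H) ↔ b⁻¹ * h * b ∈ H := by
    rw [MulAction.mem_stabilizer_iff, eq_comm]
    change (b : G ⧸ H) = ((h * b : G) : G ⧸ H) ↔ _
    rw [QuotientGroup.eq, mul_assoc]
  have stab : Nat.card (MulAction.stabilizer H ((a⁻¹ : G) : G ⧸ H)) =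
      Nat.card (MulAction.stabilizer H (a : G ⧸ H)) := by
    refine Nat.card_congr
      ⟨fun h => ⟨⟨a * h.1 * a⁻¹, by simpa using (mem _ _).1 h.2⟩, (mem _ _).2 ?_⟩,
        fun h => ⟨⟨a⁻¹ * h.1 * a, (mem _ _).1 h.2⟩, (mem _ _).2 ?_⟩, fun h => ?_, fun h => ?_⟩
    · have : a⁻¹ * (a * h.1 * a⁻¹) * a = h.1 := by group
      simp only [this, SetLike.coe_mem]
    · have : a⁻¹⁻¹ * (a⁻¹ * h.1 * a) * a⁻¹ = h.1 := by group
      simp only [this, SetLike.coe_mem]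
    · ext
      simp [mul_assoc]
    · ext
      simp [mul_assoc]
  have h1 := key a
  have h2 := key a⁻¹
  rw [inv_inv, ← stab] at h2
  exact Nat.eq_of_mul_eq_mul_right Nat.card_pos (h1.trans h2.symm)

open Classical in
/-- An inverse-closed system of representatives exists for a set of left cosets that meets linked
double cosets in equally many left cosets, and in which each self-inverse double coset with an odd
number of left cosets contains an element that is its own inverse. -/
theorem exists_inv_closed_representatives (A : Finset (G ⧸ H))
    (h_card : ∀ q r, CosetLink H q r →
      (A.filter (CosetLink H q)).card = (A.filter (CosetLink H r)).card)
    (h_odd : ∀ q ∈ A, CosetLink H q q → Odd (A.filter (CosetLink H q)).card →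
      ∃ s : G, s⁻¹ = s ∧ (s : G ⧸ H) ∈ A ∧ CosetLink H q s) :
    ∃ T : Set G, (∀ t ∈ T, t⁻¹ ∈ T) ∧ (∀ t ∈ T, (t : G ⧸ H) ∈ A) ∧
      ∀ q ∈ A, ∃! t, t ∈ T ∧ (t : G ⧸ H) = q := by
  induction hn : A.card using Nat.strong_induction_on generalizing A with
  | _ n ih =>
  subst hn
  have link (p p' q r : G ⧸ H) (h1 : CosetLink H p p') (h2 : CosetLink H q r) :
      CosetLink H p q → CosetLink H p' r := fun h3 =>
    (h2.symm.difunctional h3 h1).symm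
  -- Induction step: `s` and `s⁻¹` represent their cosets, which leave `A`. `heq` prevents two
  -- representatives in one coset; by `heven` the self-inverse classes that lose cosets keep an even
  -- number, so `h_odd` survives.
  have step (s : G) (hs : (s : G ⧸ H) ∈ A) (hs' : ((s⁻¹ : G) : G ⧸ H) ∈ A)
      (heq : (s : G ⧸ H) = ((s⁻¹ : G) : G ⧸ H) → s⁻¹ = s)
      (heven : ∀ p, CosetLink H p p → CosetLink H p s → ¬ Odd
        (((A.filter (CosetLink H p)).erase (s : G ⧸ H)).erase ((s⁻¹ : G) : G ⧸ H)).card) :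
      ∃ T : Set G, (∀ t ∈ T, t⁻¹ ∈ T) ∧ (∀ t ∈ T, (t : G ⧸ H) ∈ A) ∧
        ∀ q ∈ A, ∃! t, t ∈ T ∧ (t : G ⧸ H) = q := by
    have hlink : CosetLink H (s : G ⧸ H) ((s⁻¹ : G) : G ⧸ H) := ⟨s, rfl, rfl⟩
    generalize hq : (s : G ⧸ H) = q at *
    generalize hr : ((s⁻¹ : G) : G ⧸ H) = r at *
    have hfilter (p : G ⧸ H) : ((A.erase q).erase r).filter (CosetLink H p) =
        ((A.filter (CosetLink H p)).erase q).erase r := by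
      ext x
      simp only [Finset.mem_filter, Finset.mem_erase]
      tauto
    obtain ⟨T, hT_inv, hT_mem, hT⟩ := ih ((A.erase q).erase r).card
      (Finset.card_lt_card ((Finset.erase_subset _ _).trans_ssubset (Finset.erase_ssubset hs)))
      ((A.erase q).erase r) (fun p p' hp => by
        have h1 := link p p' q r hp hlink
        have h2 := link p p' r q hp hlink.symm
        have h3 := link p' p q r hp.symm hlink
        have h4 := link p' p r q hp.symm hlink.symm
        have h5 := h_card p p' hp
        rw [hfilter, hfilter]
        simp only [Finset.card_erase_eq_ite, Finset.mem_erase, Finset.mem_filter, hs, hs', h5,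
          true_and]
        by_cases hqr : q = r
        · subst hqr
          have : CosetLink H p q ↔ CosetLink H p' q := ⟨h1, h3⟩
          simp [this]
        · have e1 : CosetLink H p q ↔ CosetLink H p' r := ⟨h1, h4⟩
          have e2 : CosetLink H p r ↔ CosetLink H p' q := ⟨h2, h3⟩
          simp only [e1, e2]
          split_ifs <;> simp_all) (fun p hp hpp hodd => by
        rw [hfilter] at hodd
        by_cases hpq : CosetLink H p q
        · exact absurd hodd (heven p hpp hpq)
        have hpr : ¬ CosetLink H p r := fun h => hpq (link p p r q hpp hlink.symm h)
        rw [Finset.erase_eq_of_notMem (by simp [hpr]),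
          Finset.erase_eq_of_notMem (by simp [hpq])] at hodd
        obtain ⟨t, ht, htA, hpt⟩ := h_odd p (Finset.mem_of_mem_erase (Finset.mem_of_mem_erase hp))
          hpp hodd
        refine ⟨t, ht, Finset.mem_erase.2 ⟨?_, Finset.mem_erase.2 ⟨?_, htA⟩⟩, hpt⟩
        · rintro h
          exact hpr (h ▸ hpt)
        · rintro h
          exact hpq (h ▸ hpt)) rfl
    have hT_ne (t : G) (ht : t ∈ T) : (t : G ⧸ H) ≠ q ∧ (t : G ⧸ H) ≠ r := by
      have := hT_mem t ht
      simp only [Finset.mem_erase] at this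
      tauto
    refine ⟨T ∪ {s, s⁻¹}, ?_, ?_, ?_⟩
    · rintro t (ht | rfl | rfl)
      · exact Or.inl (hT_inv t ht)
      · simp
      · simp
    · rintro t (ht | rfl | rfl)
      · exact Finset.mem_of_mem_erase (Finset.mem_of_mem_erase (hT_mem t ht))
      · rwa [hq]
      · rwa [hr]
    · intro p hp
      by_cases hpq : p = q
      · subst hpq
        refine ⟨s, ⟨by simp, hq⟩, ?_⟩
        rintro t ⟨ht | rfl | rfl, h⟩
        · exact absurd h (hT_ne t ht).1
        · rfl
        · exact heq (h.symm.trans hr)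
      by_cases hpr : p = r
      · subst hpr
        refine ⟨s⁻¹, ⟨by simp, hr⟩, ?_⟩
        rintro t ⟨ht | rfl | rfl, h⟩
        · exact absurd h (hT_ne t ht).2
        · exact absurd (h.symm.trans hq) hpq
        · rfl
      · obtain ⟨t, ⟨ht, htp⟩, huniq⟩ := hT p (by simp [hpq, hpr, hp])
        refine ⟨t, ⟨Or.inl ht, htp⟩, ?_⟩
        rintro u ⟨hu | rfl | rfl, h⟩
        · exact huniq u ⟨hu, h⟩
        · exact absurd (h.symm.trans hq) hpq
        · exact absurd (h.symm.trans hr) hpr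
  rcases A.eq_empty_or_nonempty with rfl | ⟨q, hq⟩
  · exact ⟨∅, by simp, by simp, by simp⟩
  -- An odd self-inverse class loses the coset of a self-inverse element, an even one loses two
  -- distinct linked cosets, and otherwise each of two mutually inverse classes loses one.
  by_cases hqq : CosetLink H q q
  · by_cases hodd : Odd (A.filter (CosetLink H q)).card
    · obtain ⟨s, hs, hsA, hqs⟩ := h_odd q hq hqq hodd
      refine step s hsA (by rwa [hs]) (fun _ => hs) fun p hpp hps => ?_
      have hmem : (s : G ⧸ H) ∈ A.filter (CosetLink H p) := by simp [hsA, hps]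
      rw [h_card q s hqs, ← h_card p s hps] at hodd
      rw [hs, Finset.erase_idem, Finset.card_erase_of_mem hmem, Nat.not_odd_iff_even]
      exact hodd.tsub_odd odd_one
    · have hmem : q ∈ A.filter (CosetLink H q) := by simp [hq, hqq]
      obtain ⟨r, hr, hrq⟩ : ∃ r ∈ A.filter (CosetLink H q), r ≠ q := by
        apply Finset.exists_mem_ne
        have := Finset.card_pos.2 ⟨q, hmem⟩
        rw [Nat.not_odd_iff_even] at hodd
        obtain ⟨k, hk⟩ := hodd
        omega
      rw [Finset.mem_filter] at hr
      obtain ⟨hrA, s, rfl, rfl⟩ := hr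
      refine step s hq hrA (fun h => absurd h.symm hrq) fun p hpp hps => ?_
      have hmem : (s : G ⧸ H) ∈ A.filter (CosetLink H p) := by simp [hq, hps]
      have hmem' : ((s⁻¹ : G) : G ⧸ H) ∈ (A.filter (CosetLink H p)).erase (s : G ⧸ H) := by
        simp [hrA, hrq, link p p _ _ hpp ⟨s, rfl, rfl⟩ hps]
      rw [← h_card p s hps] at hodd
      rw [Finset.card_erase_of_mem hmem', Finset.card_erase_of_mem hmem]
      rw [Nat.not_odd_iff_even] at hodd ⊢
      rw [Nat.sub_sub]
      exact hodd.tsub even_two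
  · obtain ⟨r₀, hr₀⟩ := exists_cosetLink q
    obtain ⟨r, hr⟩ : (A.filter (CosetLink H q)).Nonempty := by
      rw [← Finset.card_pos, h_card q r₀ hr₀, Finset.card_pos]
      exact ⟨q, by simp [hq, hr₀.symm]⟩
    rw [Finset.mem_filter] at hr
    obtain ⟨hrA, s, rfl, rfl⟩ := hr
    have hl : CosetLink H (s : G ⧸ H) ((s⁻¹ : G) : G ⧸ H) := ⟨s, rfl, rfl⟩
    refine step s hq hrA (fun h => absurd ?_ hqq) fun p hpp hps => ?_
    · rw [← h] at hl
      exact hl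
    · exact absurd (hl.difunctional (link p p _ _ hpp hl hps) hps) hqq

/-- A subgroup `H` is a perfect code if each self-inverse double coset `HxH ≠ H` that consists of
an odd number of left cosets contains an element that is its own inverse. -/
theorem isGroupPerfectCode_of_forall_odd [Finite G]
    (h : ∀ x ∉ H, x * x ∈ H → Odd (Nat.card (MulAction.orbit H (x : G ⧸ H))) →
      ∃ y : G, y⁻¹ = y ∧ (y : G ⧸ H) ∈ MulAction.orbit H (x : G ⧸ H)) :
    IsGroupPerfectCode (H : Set G) := by
  classical
  have := Fintype.ofFinite (G ⧸ H)
  have link_one (q : G ⧸ H) (hq : q ≠ ((1 : G) : G ⧸ H)) :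
      ¬ CosetLink H q ((1 : G) : G ⧸ H) := by
    rintro ⟨a, rfl, ha⟩
    rw [eq_comm, QuotientGroup.eq] at ha
    exact hq (QuotientGroup.eq.2 (by simpa using ha))
  have link_one' (q : G ⧸ H) (hq : q ≠ ((1 : G) : G ⧸ H)) :
      ¬ CosetLink H ((1 : G) : G ⧸ H) q := fun hl => link_one q hq hl.symm
  have hfilter (q : G ⧸ H) (hq : q ≠ ((1 : G) : G ⧸ H)) :
      ((Finset.univ.erase ((1 : G) : G ⧸ H)).filter (CosetLink H q)).card =
        Nat.card {s // CosetLink H q s} := by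
    rw [Nat.card_eq_fintype_card, Fintype.card_subtype]
    congr 1
    ext r
    simp only [Finset.mem_filter, Finset.mem_erase, Finset.mem_univ, and_true, true_and,
      and_iff_right_iff_imp]
    rintro hl rfl
    exact link_one q hq hl
  obtain ⟨T, hT_inv, hT_mem, hT⟩ := exists_inv_closed_representatives
    (Finset.univ.erase ((1 : G) : G ⧸ H)) (fun q r hl => by
      by_cases hq : q = ((1 : G) : G ⧸ H)
      · have hr : r = ((1 : G) : G ⧸ H) := by
          by_contra hr
          exact link_one' r hr (hq ▸ hl)
        rw [hq, hr]
      · have hr : r ≠ ((1 : G) : G ⧸ H) := by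
          rintro rfl
          exact link_one q hq hl
        rw [hfilter q hq, hfilter r hr, hl.card_eq]) (fun q hq hqq hodd => by
      have hq1 : q ≠ ((1 : G) : G ⧸ H) := Finset.ne_of_mem_erase hq
      rw [hfilter q hq1] at hodd
      obtain ⟨x, rfl, hx⟩ := hqq
      have hx_inv : (CosetLink H (x : G ⧸ H)) = fun r => r ∈ MulAction.orbit H (x : G ⧸ H) := by
        ext r
        rw [cosetLink_mk_inv_iff, hx]
      rw [hx_inv] at hodd ⊢
      obtain ⟨y, hy, hyx⟩ := h x (fun hxH => hq1 (QuotientGroup.eq.2 (by simpa using hxH)))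
        (by simpa using QuotientGroup.eq.1 hx) hodd
      refine ⟨y, hy, Finset.mem_erase.2 ⟨?_, Finset.mem_univ _⟩, hyx⟩
      intro hy1
      rw [← hx, ← cosetLink_mk_inv_iff, hy1] at hyx
      exact link_one _ hq1 hyx)
  refine isGroupPerfectCode_of_transversal hT_inv (fun s hs hsH => ?_) fun x hx => ?_
  · exact Finset.ne_of_mem_erase (hT_mem s hs) (QuotientGroup.eq.2 (by simpa using hsH))
  · obtain ⟨s, ⟨hs, hsx⟩, huniq⟩ := hT (x : G ⧸ H) (by
      rw [Finset.mem_erase]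
      refine ⟨fun h1 => hx ?_, Finset.mem_univ _⟩
      simpa using QuotientGroup.eq.1 h1)
    exact ⟨s, ⟨hs, QuotientGroup.eq.1 hsx.symm⟩,
      fun t ht => huniq t ⟨ht.1, (QuotientGroup.eq.2 ht.2).symm⟩⟩

/-! ### Which subgroups are perfect codes -/

/-- A subgroup of odd order is a perfect code. -/
theorem isGroupPerfectCode_of_odd_card [Finite G] (hH : Odd (Nat.card H)) :
    IsGroupPerfectCode (H : Set G) := by
  refine isGroupPerfectCode_of_forall_odd fun x _ hxx _ => ?_
  obtain ⟨k, hk⟩ := hH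
  have hpow : (x * x) ^ (2 * k + 1) = 1 := by
    have := congrArg Subtype.val (pow_card_eq_one' (x := (⟨x * x, hxx⟩ : H)))
    rwa [hk] at this
  -- The witness is `x ^ |H|`, whose square is `(x * x) ^ |H| = 1`.
  refine ⟨x * (x * x) ^ k, ?_, ?_⟩
  · rw [inv_eq_iff_mul_eq_one, ← hpow]
    simp only [← pow_two, ← pow_mul, ← pow_succ']
    congr 1
    ring
  · have : ((x * (x * x) ^ k : G) : G ⧸ H) = x :=
      (QuotientGroup.eq.2 (by simpa using H.pow_mem hxx k)).symm
    rw [this]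
    exact MulAction.mem_orbit_self _

/-- In a `2`-group, a subgroup maximal among those avoiding an involution is a perfect code. -/
theorem IsPGroup.isGroupPerfectCode_of_maximal [Finite G] (hG : IsPGroup 2 G) {t : G}
    (ht : t⁻¹ = t) (htH : t ∉ H) (hH : ∀ K : Subgroup G, H < K → t ∈ K) :
    IsGroupPerfectCode (H : Set G) := by
  refine isGroupPerfectCode_of_forall_odd fun x hx hxx hodd => ?_
  obtain ⟨n, hn⟩ := (hG.to_subgroup H).card_orbit (x : G ⧸ H)
  -- An odd orbit of a 2-group is a single point, so `x` normalizes `H`.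
  have hone : Nat.card (MulAction.orbit H (x : G ⧸ H)) = 1 := by
    rcases n with _ | n
    · simpa using hn
    · rw [hn] at hodd
      exact absurd hodd (by simp [Nat.pow_succ])
  have hsub := (Nat.card_eq_one_iff_unique.1 hone).1
  have hfix (h : G) (hh : h ∈ H) : x⁻¹ * h * x ∈ H := by
    have := congrArg Subtype.val (hsub.elim
      ⟨(x : G ⧸ H), MulAction.mem_orbit_self _⟩
      ⟨(⟨h, hh⟩ : H) • (x : G ⧸ H), MulAction.mem_orbit _ _⟩)
    change (x : G ⧸ H) = ((h * x : G) : G ⧸ H) at this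
    rw [QuotientGroup.eq, ← mul_assoc] at this
    exact this
  -- `K = H ∪ xH` properly contains `H`, hence contains `t`, which then lies in `xH`.
  let K : Subgroup G :=
    { carrier := {g | g ∈ H ∨ x⁻¹ * g ∈ H}
      one_mem' := Or.inl H.one_mem
      mul_mem' := by
        rintro a b (ha | ha) (hb | hb)
        · exact Or.inl (H.mul_mem ha hb)
        · refine Or.inr ?_
          have := H.mul_mem (hfix a ha) hb
          rwa [show x⁻¹ * a * x * (x⁻¹ * b) = x⁻¹ * (a * b) by group] at this
        · refine Or.inr ?_
          rw [← mul_assoc]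
          exact H.mul_mem ha hb
        · refine Or.inl ?_
          have := H.mul_mem (H.mul_mem hxx (hfix _ ha)) hb
          rwa [show x * x * (x⁻¹ * (x⁻¹ * a) * x) * (x⁻¹ * b) = a * b by group] at this
      inv_mem' := by
        rintro a (ha | ha)
        · exact Or.inl (H.inv_mem ha)
        · refine Or.inr ?_
          have := H.mul_mem (hfix _ (H.inv_mem ha)) (H.inv_mem hxx)
          rwa [show x⁻¹ * (x⁻¹ * a)⁻¹ * x * (x * x)⁻¹ = x⁻¹ * a⁻¹ by group] at this }
  have hxK : x ∈ K := Or.inr (by simp)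
  refine ⟨t, ht, ?_⟩
  rcases hH K (lt_of_le_of_ne (fun h hh => Or.inl hh) (fun h => hx (h ▸ hxK))) with h | h
  · exact absurd h htH
  · rw [← QuotientGroup.eq.2 h]
    exact MulAction.mem_orbit_self _

/-- Every element outside a subgroup of a `2`-group has a power outside it whose square is in it. -/
theorem IsPGroup.exists_pow_notMem_and_sq_mem (hG : IsPGroup 2 G) {x : G} (hx : x ∉ H) :
    ∃ k, x ^ 2 ^ k ∉ H ∧ x ^ 2 ^ k * x ^ 2 ^ k ∈ H := by
  classical
  have hex : ∃ k, x ^ 2 ^ k ∈ H := by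
    obtain ⟨k, hk⟩ := hG x
    exact ⟨k, hk ▸ H.one_mem⟩
  obtain ⟨k, hk⟩ : ∃ k, Nat.find hex = k + 1 :=
    Nat.exists_eq_succ_of_ne_zero fun h => hx (by simpa [h] using Nat.find_spec hex)
  have hxx := Nat.find_spec hex
  rw [hk, pow_succ, pow_mul, pow_two] at hxx
  exact ⟨k, Nat.find_min hex (m := k) (by omega), hxx⟩

/-- A proper nontrivial subgroup of a `2`-group with a unique involution is not a perfect code. -/
theorem IsPGroup.not_isGroupPerfectCode [Finite G] (hG : IsPGroup 2 G)
    (h_unique : ∃! x : G, orderOf x = 2) (h_bot : H ≠ ⊥) (h_top : H ≠ ⊤) :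
    ¬ IsGroupPerfectCode (H : Set G) := by
  have : Fact (Nat.Prime 2) := ⟨Nat.prime_two⟩
  intro hcode
  obtain ⟨S, h_inv, hS⟩ := exists_transversal_of_isGroupPerfectCode hcode
  have := hG.isNilpotent
  obtain ⟨u, huH⟩ : ∃ u : H, orderOf u = 2 := by
    apply exists_prime_orderOf_dvd_card' 2
    refine ((hG.to_subgroup H).card_eq_or_dvd).resolve_left fun h => h_bot ?_
    exact Subgroup.card_eq_one.1 h
  obtain ⟨g, hgN, hgH⟩ := SetLike.exists_of_lt
    (Group.normalizerCondition_of_isNilpotent H (lt_top_iff_ne_top.2 h_top))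
  obtain ⟨k, hx, hxx⟩ := hG.exists_pow_notMem_and_sq_mem hgH
  have hxN : g ^ 2 ^ k ∈ Subgroup.normalizer (H : Set G) := pow_mem hgN _
  generalize g ^ 2 ^ k = x at *
  obtain ⟨s, ⟨hs, hxs⟩, huniq⟩ := hS x hx
  rw [Subgroup.mem_normalizer_iff''] at hxN
  -- The coset `xH` is closed under inversion, so uniqueness applies to `s⁻¹`.
  have hinv : s⁻¹ = s := by
    refine huniq s⁻¹ ⟨h_inv s hs, ?_⟩
    have := H.mul_mem ((hxN _).1 (H.inv_mem hxs)) (H.inv_mem hxx)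
    rwa [show x⁻¹ * (x⁻¹ * s)⁻¹ * x * (x * x)⁻¹ = x⁻¹ * s⁻¹ by group] at this
  have hsH : s ∉ H := fun h => hx (by simpa using H.mul_mem h (H.inv_mem hxs))
  have hs2 : orderOf s = 2 := by
    rw [orderOf_eq_prime_iff]
    refine ⟨?_, fun h => hsH (h ▸ H.one_mem)⟩
    rw [pow_two, ← inv_eq_iff_mul_eq_one, hinv]
  refine hsH ?_
  rw [h_unique.unique hs2 ((Subgroup.orderOf_coe u).trans huH)]
  exact u.2

/-- A finite group of composite order without proper nontrivial subgroups that are perfect codes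
is a `2`-group with a unique involution. -/
theorem isPGroup_two_and_existsUnique_involution [Finite G]
    (h_gt : 1 < Nat.card G) (h_not_prime : ¬ (Nat.card G).Prime)
    (h : ∀ H : Subgroup G, H ≠ ⊥ → H ≠ ⊤ → ¬ IsGroupPerfectCode (H : Set G)) :
    IsPGroup 2 G ∧ ∃! x : G, orderOf x = 2 := by
  have : Fact (Nat.Prime 2) := ⟨Nat.prime_two⟩
  have hprime (p : ℕ) (hp : p.Prime) (hdvd : p ∣ Nat.card G) : p = 2 := by
    have : Fact p.Prime := ⟨hp⟩
    obtain ⟨x, hx⟩ := exists_prime_orderOf_dvd_card' p hdvd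
    by_contra hp2
    have hcard : Nat.card (Subgroup.zpowers x) = p := (Nat.card_zpowers x).trans hx
    refine h (Subgroup.zpowers x) (fun h1 => ?_) (fun h1 => ?_)
      (isGroupPerfectCode_of_odd_card (hcard ▸ hp.odd_of_ne_two hp2))
    · rw [h1, Subgroup.card_bot] at hcard
      exact hp.one_lt.ne hcard
    · rw [h1, Subgroup.card_top] at hcard
      exact h_not_prime (hcard ▸ hp)
  have hG : IsPGroup 2 G := IsPGroup.of_card
    (Nat.eq_prime_pow_of_unique_prime_dvd (by omega) fun {d} hd hdvd => hprime d hd hdvd)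
  refine ⟨hG, ?_⟩
  obtain ⟨z, hz⟩ := exists_prime_orderOf_dvd_card' (G := G) 2
    (hG.card_eq_or_dvd.resolve_left (by omega))
  refine ⟨z, hz, fun t ht => ?_⟩
  by_contra htz
  have hz' := orderOf_eq_prime_iff.1 hz
  have ht' := orderOf_eq_prime_iff.1 ht
  have htz' : t ∉ Subgroup.zpowers z := by
    rintro ⟨k, rfl⟩
    rcases Int.even_or_odd' k with ⟨m, rfl | rfl⟩
    · exact ht'.2 (by simp [zpow_mul, hz'.1])
    · exact htz (by simp [zpow_add, zpow_mul, hz'.1])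
  obtain ⟨H, hzH, hH⟩ := (Set.toFinite {K : Subgroup G | t ∉ K}).exists_le_maximal htz'
  refine h H ?_ ?_ (hG.isGroupPerfectCode_of_maximal (t := t) ?_ hH.prop fun K hK => ?_)
  · rintro rfl
    exact hz'.2 (Subgroup.mem_bot.1 (hzH (Subgroup.mem_zpowers z)))
  · rintro rfl
    exact hH.prop (Subgroup.mem_top t)
  · rw [inv_eq_iff_mul_eq_one, ← pow_two, ht'.1]
  · by_contra htK
    exact hK.not_ge (hH.2 htK hK.le)

end PerfectCode

/-! ### Classification of 2-groups with a unique involution -/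

section TwoGroup

open scoped commutatorElement

variable {G : Type*} [Group G]

theorem inv_mul_pow_mul_self (b a : G) (n : ℕ) : b⁻¹ * a ^ n * b = (b⁻¹ * a * b) ^ n := by
  simpa using (conj_pow (i := n) (a := b⁻¹) (b := a)).symm

/-- Square of an element of the coset `b⟨a⟩`, where `b` acts on `a` as the `r`-th power. -/
theorem mul_pow_sq_of_conj_eq_pow {a b : G} {k r : ℕ} (hb : b * b = a ^ k)
    (hconj : b⁻¹ * a * b = a ^ r) (j : ℕ) : (b * a ^ j) * (b * a ^ j) = a ^ (k + j * (r + 1)) := by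
  have h1 : (b * a ^ j) * (b * a ^ j) = (b * b) * (b⁻¹ * a ^ j * b) * a ^ j := by group
  rw [h1, inv_mul_pow_mul_self, hb, hconj, ← pow_mul, ← pow_add, ← pow_add]
  congr 1
  ring

/-- Suppose all elements of order two lie in the cyclic `2`-group `⟨a⟩`, and `b ∉ ⟨a⟩` normalizes
`⟨a⟩` and has its square in `⟨a⟩`. Then `⟨a, b⟩ = ⟨b⟩` is cyclic, or `b` inverts `a` and has
order `4`. -/
theorem mem_zpowers_or_conj_eq_inv {a b z : G} (hG : IsPGroup 2 G)
    (hz : ∀ x : G, orderOf x = 2 ↔ x = z) (hzA : z ∈ Subgroup.zpowers a)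
    (hbA : b ∉ Subgroup.zpowers a) {k r : ℕ} (hb : b * b = a ^ k)
    (hconj : b⁻¹ * a * b = a ^ r) :
    a ∈ Subgroup.zpowers b ∨ (b⁻¹ * a * b = a⁻¹ ∧ b * b = z) := by
  have : Fact (Nat.Prime 2) := ⟨Nat.prime_two⟩
  -- Otherwise `b * a ^ j` would be an involution outside `⟨a⟩`.
  have hne (j : ℕ) : a ^ (k + j * (r + 1)) ≠ 1 := by
    rw [← mul_pow_sq_of_conj_eq_pow hb hconj]
    intro h
    have hnot : b * a ^ j ∉ Subgroup.zpowers a := fun h =>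
      hbA (((Subgroup.zpowers a).mul_mem_cancel_right (pow_mem (Subgroup.mem_zpowers a) j)).1 h)
    refine hnot ?_
    rw [(hz _).1 (orderOf_eq_prime (by rw [pow_two, h]) fun h1 : b * a ^ j = 1 =>
      hnot (by rw [h1]; exact one_mem _))]
    exact hzA
  obtain ⟨n, hn⟩ := IsPGroup.iff_orderOf.1 hG a
  rcases Nat.even_or_odd k with hk | hk
  swap
  · left
    obtain ⟨m, hm⟩ := exists_pow_eq_self_of_coprime (x := a) (n := k)
      (by rw [hn]; exact (Nat.coprime_two_right.2 hk).pow_right n)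
    rw [← hm, ← hb]
    exact pow_mem (mul_mem (Subgroup.mem_zpowers b) (Subgroup.mem_zpowers b)) m
  right
  -- `b` commutes with `b * b = a ^ k`.
  have hkr : a ^ (k * r) = a ^ k := by
    rw [mul_comm, pow_mul, ← hconj, ← inv_mul_pow_mul_self, ← hb]
    group
  have hkr' : (2 ^ n : ℤ) ∣ k * (r - 1) := by
    rw [pow_eq_pow_iff_modEq, hn, Nat.modEq_iff_dvd, ← dvd_neg] at hkr
    push_cast at hkr
    rwa [show (k * (r - 1) : ℤ) = -(k - k * r) by ring]
  have hne' (j : ℕ) : ¬ (2 ^ n : ℤ) ∣ k + j * (r + 1) := by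
    have := hne j
    rw [Ne, ← orderOf_dvd_iff_pow_eq_one, hn] at this
    exact_mod_cast this
  have hodd_coprime (u : ℤ) (hu : Odd u) : IsCoprime (2 ^ n : ℤ) u := by
    apply IsCoprime.pow_left
    obtain ⟨v, rfl⟩ := hu
    exact ⟨-v, 1, by ring⟩
  have hr : Odd (r : ℤ) := by
    by_contra hr
    rw [Int.not_odd_iff_even] at hr
    refine hne' 0 ?_
    simpa using (hodd_coprime _ (hr.sub_odd odd_one)).dvd_of_dvd_mul_right hkr'
  obtain ⟨l, rfl⟩ := hk
  obtain ⟨m, hm⟩ := hr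
  rcases Int.even_or_odd m with hm2 | hm2
  -- Here `k = 2l` and `r + 1 = 2(m + 1)` with `m + 1` invertible modulo `2 ^ n`, so some `j` solves
  -- `k + j(r + 1) ≡ 0`, against `hne'`.
  · exfalso
    obtain ⟨x, y, hxy⟩ := hodd_coprime (m + 1) hm2.add_one
    obtain ⟨j, hj⟩ : ∃ j : ℕ, (2 ^ n : ℤ) ∣ j + l * y := by
      have hpos : (0 : ℤ) < 2 ^ n := by positivity
      refine ⟨((-(l * y)) % 2 ^ n).toNat, ?_⟩
      rw [Int.toNat_of_nonneg (Int.emod_nonneg _ hpos.ne')]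
      have := Int.emod_add_mul_ediv (-(l * y)) (2 ^ n)
      exact ⟨-(-(l * y) / 2 ^ n), by linarith⟩
    refine hne' j ?_
    obtain ⟨c, hc⟩ := hj
    refine ⟨2 * c * (m + 1) + 2 * l * x, ?_⟩
    rw [hm]
    have : (j : ℤ) = 2 ^ n * c - l * y := by linarith
    rw [this]
    push_cast
    linear_combination (-2 * l : ℤ) * hxy
  · have h2k : (2 ^ n : ℤ) ∣ 2 * (l + l) := by
      refine (hodd_coprime m hm2).dvd_of_dvd_mul_right ?_
      rw [hm] at hkr'
      have h : (2 * (l + l) * m : ℤ) = ((l + l : ℕ) : ℤ) * (2 * m + 1 - 1) := by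
        push_cast
        ring
      rw [h]
      exact hkr'
    have hbz : b * b = z := by
      rw [← hz, hb]
      refine orderOf_eq_prime ?_ (by simpa using hne 0)
      rw [← pow_mul, ← orderOf_dvd_iff_pow_eq_one, hn, mul_comm]
      exact_mod_cast h2k
    refine ⟨?_, hbz⟩
    rw [hconj, eq_inv_iff_mul_eq_one, ← pow_succ]
    -- Otherwise `z` is a power `(a ^ (r + 1)) ^ 2 ^ i`, and `b * a ^ 2 ^ i` has square `z * z = 1`.
    by_contra h
    obtain ⟨i, hi⟩ := IsPGroup.iff_orderOf.1 hG (a ^ (r + 1))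
    rcases i with _ | i
    · exact h (orderOf_eq_one_iff.1 (by simpa using hi))
    have hpow : (a ^ (r + 1)) ^ 2 ^ i = z := by
      rw [← hz, orderOf_pow_of_dvd (by positivity) (by rw [hi]; exact pow_dvd_pow 2 (by omega)),
        hi, pow_succ, Nat.mul_div_cancel_left _ (by positivity)]
    refine hne (2 ^ i) ?_
    rw [pow_add, ← hb, hbz, mul_comm, pow_mul, hpow, ← pow_two]
    rw [← orderOf_dvd_iff_pow_eq_one, (hz z).2 rfl]

/-- The element of a group with parameters as in a generalized quaternion group that corresponds
to an element of `QuaternionGroup n`. -/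
def quaternionGroupLift (a b : G) {n : ℕ} : QuaternionGroup n → G
  | .a i => a ^ i.val
  | .xa i => b * a ^ i.val

/-- By `hcover` the only cosets are `⟨a⟩` and `b⟨a⟩`, so `quaternionGroupLift` is a bijective normal
form. -/
theorem nonempty_mulEquiv_quaternionGroup {a b : G} {n : ℕ} [NeZero n] (ha : orderOf a = 2 * n)
    (hbA : b ∉ Subgroup.zpowers a) (hb : b * b = a ^ n) (hconj : b⁻¹ * a * b = a⁻¹)
    (hcover : ∀ x, x ∉ Subgroup.zpowers a → b⁻¹ * x ∈ Subgroup.zpowers a) :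
    Nonempty (G ≃* QuaternionGroup n) := by
  have hcast (m : ℕ) : a ^ (m : ZMod (2 * n)).val = a ^ m := by
    rw [ZMod.val_natCast, ← ha, pow_mod_orderOf]
  have hadd (i j : ZMod (2 * n)) : a ^ (i + j).val = a ^ i.val * a ^ j.val := by
    rw [← pow_add, ← hcast (i.val + j.val), Nat.cast_add, ZMod.natCast_zmod_val, ZMod.natCast_zmod_val]
  have hsub (i j : ZMod (2 * n)) : a ^ (i - j).val = a ^ i.val * (a ^ j.val)⁻¹ := by
    rw [eq_mul_inv_iff_mul_eq, ← hadd, sub_add_cancel]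
  have hswap (m : ℕ) : a ^ m * b = b * (a ^ m)⁻¹ := by
    rw [← inv_pow, ← hconj, ← inv_mul_pow_mul_self]
    group
  have hcomm (l m : ℕ) : (a ^ l)⁻¹ * a ^ m = a ^ m * (a ^ l)⁻¹ :=
    ((Commute.refl a).pow_pow l m).inv_left.eq
  have hmul (x y : QuaternionGroup n) : quaternionGroupLift a b (x * y) =
      quaternionGroupLift a b x * quaternionGroupLift a b y := by
    rcases x with i | i <;> rcases y with j | j
    · simp [quaternionGroupLift, hadd]
    · simp only [quaternionGroupLift, QuaternionGroup.a_mul_xa, hsub]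
      rw [← hcomm, ← mul_assoc, ← mul_assoc, hswap]
    · simp [quaternionGroupLift, hadd, mul_assoc]
    · simp only [quaternionGroupLift, QuaternionGroup.xa_mul_xa, hsub, hadd, hcast]
      rw [mul_assoc b, ← mul_assoc _ b, hswap, mul_assoc b, hcomm, ← mul_assoc b, hb, mul_assoc]
  have hinj : Function.Injective (quaternionGroupLift a b (n := n)) := by
    have hval (i j : ZMod (2 * n)) (h : a ^ i.val = a ^ j.val) : i = j := by
      apply ZMod.val_injective
      refine pow_injOn_Iio_orderOf ?_ ?_ h
      · rw [Set.mem_Iio, ha]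
        exact ZMod.val_lt i
      · rw [Set.mem_Iio, ha]
        exact ZMod.val_lt j
    have hnot (l m : ℕ) : a ^ l ≠ b * a ^ m := fun h => hbA <| by
      rw [eq_mul_inv_of_mul_eq h.symm]
      exact mul_mem (pow_mem (Subgroup.mem_zpowers a) _)
        (inv_mem (pow_mem (Subgroup.mem_zpowers a) _))
    rintro (i | i) (j | j) h
    · rw [hval i j h]
    · exact absurd h (hnot _ _)
    · exact absurd h.symm (hnot _ _)
    · rw [hval i j (mul_left_cancel h)]
  have hpow (x : G) (hx : x ∈ Subgroup.zpowers a) : ∃ i : ZMod (2 * n), a ^ i.val = x := by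
    have hfin : IsOfFinOrder a := orderOf_pos_iff.1 (by rw [ha]; exact NeZero.pos _)
    obtain ⟨m, rfl⟩ := hfin.mem_powers_iff_mem_zpowers.2 hx
    exact ⟨m, hcast m⟩
  have hsurj : Function.Surjective (quaternionGroupLift a b (n := n)) := by
    intro x
    by_cases hx : x ∈ Subgroup.zpowers a
    · obtain ⟨i, hi⟩ := hpow x hx
      exact ⟨.a i, hi⟩
    · obtain ⟨i, hi⟩ := hpow _ (hcover x hx)
      exact ⟨.xa i, by simp [quaternionGroupLift, hi]⟩
  exact ⟨(MulEquiv.ofBijective (MulHom.mk _ hmul) ⟨hinj, hsurj⟩).symm⟩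

/-- In a finite `2`-group with a unique involution, a maximal normal cyclic subgroup is its own
centralizer. -/
theorem mem_zpowers_of_commute [Finite G] {a z : G} (hG : IsPGroup 2 G)
    (hz : ∀ x : G, orderOf x = 2 ↔ x = z) (hzA : z ∈ Subgroup.zpowers a)
    (hA : (Subgroup.zpowers a).Normal)
    (hmax : ∀ y : G, (Subgroup.zpowers y).Normal → a ∈ Subgroup.zpowers y →
      y ∈ Subgroup.zpowers a) {x : G} (hx : Commute x a) : x ∈ Subgroup.zpowers a := by
  have : Fact (Nat.Prime 2) := ⟨Nat.prime_two⟩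
  have := hG.isNilpotent
  classical
  let C := Subgroup.centralizer (Subgroup.zpowers a : Set G)
  have hC (y : G) : y ∈ C ↔ Commute y a := by
    rw [Subgroup.mem_centralizer_iff]
    constructor
    · intro h
      exact (h a (Subgroup.mem_zpowers a)).symm
    · rintro h _ ⟨i, rfl⟩
      exact (h.zpow_right i).symm.eq
  have hCn : C.Normal := inferInstance
  by_contra hxA
  -- For the least such `i`, commutators of a witness lie one step lower in the upper central series
  -- and in `C`, hence in `⟨a⟩`. This will make `⟨y⟩ ⊇ ⟨a⟩` normal, against maximality.
  have hex : ∃ i, ∃ y ∈ Subgroup.upperCentralSeries G i, y ∈ C ∧ y ∉ Subgroup.zpowers a := by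
    obtain ⟨n, hn⟩ := Group.IsNilpotent.nilpotent G
    exact ⟨n, x, hn ▸ Subgroup.mem_top x, (hC x).2 hx, hxA⟩
  obtain ⟨w, hwZ, hwC, hwA⟩ := Nat.find_spec hex
  have hmin := fun j => Nat.find_min hex (m := j)
  generalize Nat.find hex = i at hwZ hmin
  rcases i with _ | j
  · rw [Subgroup.upperCentralSeries_zero, Subgroup.mem_bot] at hwZ
    exact hwA (hwZ ▸ one_mem _)
  obtain ⟨k, hy, hyy⟩ := hG.exists_pow_notMem_and_sq_mem hwA
  have hyZ := pow_mem hwZ (2 ^ k)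
  have hyC := pow_mem hwC (2 ^ k)
  generalize w ^ 2 ^ k = y at *
  have hcomm (g : G) : ⁅y, g⁆ ∈ Subgroup.zpowers a := by
    by_contra hg
    refine hmin j (Nat.lt_succ_self j) ⟨⁅y, g⁆, ?_, ?_, hg⟩
    · exact Subgroup.mem_upperCentralSeries_succ_iff.1 hyZ g
    · rw [commutatorElement_def, mul_assoc, mul_assoc, ← mul_assoc g]
      exact mul_mem hyC (hCn.conj_mem _ (inv_mem hyC) g)
  have hya := (hC y).1 hyC
  obtain ⟨m, hm⟩ := mem_powers_iff_mem_zpowers.2 hyy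
  have hconj : y⁻¹ * a * y = a := by rw [mul_assoc, ← hya.eq, inv_mul_cancel_left]
  have hay : a ∈ Subgroup.zpowers y := by
    rcases mem_zpowers_or_conj_eq_inv hG hz hzA hy hm.symm (hconj.trans (pow_one a).symm)
      with h | ⟨h1, h2⟩
    · exact h
    · by_cases ha : a = 1
      · exact ha ▸ one_mem _
      · have : a = z := (hz a).1 (orderOf_eq_prime
          (by rw [pow_two]; nth_rewrite 1 [← hconj, h1]; exact inv_mul_cancel a) ha)
        rw [this, ← h2]
        exact mul_mem (Subgroup.mem_zpowers y) (Subgroup.mem_zpowers y)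
  refine hy (hmax y ⟨?_⟩ hay)
  have hle : Subgroup.zpowers a ≤ Subgroup.zpowers y := Subgroup.zpowers_le.2 hay
  rintro _ ⟨i, rfl⟩ g
  have hg : g * y * g⁻¹ ∈ Subgroup.zpowers y := by
    have := mul_mem (inv_mem (hle (hcomm g))) (Subgroup.mem_zpowers y)
    rwa [commutatorElement_def,
      show (y * g * y⁻¹ * g⁻¹)⁻¹ * y = g * y * g⁻¹ by group] at this
  simpa using zpow_mem hg i

/-- A finite `2`-group with a unique involution is cyclic or generalized quaternion. -/
theorem isCyclic_or_isGeneralizedQuaternion [Finite G] (hG : IsPGroup 2 G)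
    (h_unique : ∃! x : G, orderOf x = 2) : IsCyclic G ∨ IsGeneralizedQuaternion G := by
  have : Fact (Nat.Prime 2) := ⟨Nat.prime_two⟩
  obtain ⟨z, hz2, hz'⟩ := h_unique
  have hz (x : G) : orderOf x = 2 ↔ x = z := ⟨hz' x, fun h => h ▸ hz2⟩
  have hzn : (Subgroup.zpowers z).Normal := by
    refine ⟨?_⟩
    rintro _ ⟨i, rfl⟩ g
    have : g * z * g⁻¹ = z := (hz _).1 (by
      rw [← hz2]
      exact MulEquiv.orderOf_eq (MulAut.conj g) z)
    have h2 := conj_zpow (i := i) (a := g) (b := z)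
    rw [this] at h2
    exact ⟨i, h2⟩
  obtain ⟨A, hzA, ⟨hA, a, rfl⟩, hmax⟩ := (Set.toFinite {A : Subgroup G | A.Normal ∧
    ∃ a, Subgroup.zpowers a = A}).exists_le_maximal ⟨hzn, z, rfl⟩
  rw [Subgroup.zpowers_le] at hzA
  have hcent (x : G) (hx : Commute x a) : x ∈ Subgroup.zpowers a :=
    mem_zpowers_of_commute hG hz hzA hA (fun y hy hay =>
      hmax ⟨hy, y, rfl⟩ (Subgroup.zpowers_le.2 hay) (Subgroup.mem_zpowers y)) hx
  have hconj (x : G) : ∃ r : ℕ, x⁻¹ * a * x = a ^ r := by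
    have := hA.conj_mem a (Subgroup.mem_zpowers a) x⁻¹
    rw [inv_inv] at this
    obtain ⟨r, hr⟩ := mem_powers_iff_mem_zpowers.2 this
    exact ⟨r, hr.symm⟩
  have hsq (x : G) (hx : x ∉ Subgroup.zpowers a) (hxx : x * x ∈ Subgroup.zpowers a) :
      x⁻¹ * a * x = a⁻¹ ∧ x * x = z := by
    obtain ⟨k, hk⟩ := mem_powers_iff_mem_zpowers.2 hxx
    obtain ⟨r, hr⟩ := hconj x
    refine (mem_zpowers_or_conj_eq_inv hG hz hzA hx hk.symm hr).resolve_left ?_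
    rintro ⟨i, hi⟩
    exact hx (hcent x (hi ▸ (Commute.refl x).zpow_right i))
  obtain ⟨n, hn⟩ := IsPGroup.iff_orderOf.1 hG a
  have hn2 (x : G) (hx : x ∉ Subgroup.zpowers a) (hxa : x⁻¹ * a * x = a⁻¹) : 2 ≤ n := by
    by_contra! h
    have ha : a ^ 2 = 1 := by
      rw [← orderOf_dvd_iff_pow_eq_one, hn]
      exact pow_dvd_pow 2 (m := n) (n := 1) (by omega)
    refine hx (hcent x ?_)
    rw [inv_eq_of_mul_eq_one_left ((pow_two a).symm.trans ha), mul_assoc,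
      inv_mul_eq_iff_eq_mul] at hxa
    exact hxa.symm
  have hinv (x : G) (hx : x ∉ Subgroup.zpowers a) : x⁻¹ * a * x = a⁻¹ ∧ x * x = z := by
    obtain ⟨k, hy, hyy⟩ := hG.exists_pow_notMem_and_sq_mem hx
    rcases k with _ | k
    · rw [pow_zero, pow_one] at hy hyy
      exact hsq x hy hyy
    -- A square `w²` inverts `a`, and `w` sends `a` to `a ^ r`, so `r² ≡ -1` modulo `2 ^ n` with `n
    -- ≥ 2`; this fails modulo 4.
    exfalso
    have hya := (hsq _ hy hyy).1
    have hn' := hn2 _ hy hya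
    rw [pow_succ, pow_mul, pow_two] at hya
    obtain ⟨r, hr⟩ := hconj (x ^ 2 ^ k)
    generalize x ^ 2 ^ k = w at *
    have h1 : a ^ (r * r + 1) = 1 := by
      rw [pow_succ, pow_mul, ← hr, ← inv_mul_pow_mul_self, ← hr, ← eq_inv_iff_mul_eq_one, ← hya]
      group
    rw [← orderOf_dvd_iff_pow_eq_one, hn] at h1
    have h4 : 4 ∣ r * r + 1 := (pow_dvd_pow 2 hn').trans h1
    have := Nat.mod_lt r (show 4 > 0 by norm_num)
    rw [Nat.dvd_iff_mod_eq_zero, Nat.add_mod, Nat.mul_mod] at h4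
    interval_cases r % 4 <;> simp at h4
  by_cases hcyc : ∀ x, x ∈ Subgroup.zpowers a
  · exact Or.inl ⟨a, hcyc⟩
  push Not at hcyc
  obtain ⟨b, hb⟩ := hcyc
  obtain ⟨hba, hbb⟩ := hinv b hb
  obtain ⟨m, rfl⟩ := Nat.exists_eq_add_of_le' (hn2 b hb hba)
  have hn' : orderOf a = 2 * 2 ^ (m + 1) := by rw [hn]; ring
  refine Or.inr ⟨2 ^ (m + 1), ?_, nonempty_mulEquiv_quaternionGroup hn' hb ?_ hba ?_⟩
  · rw [pow_succ]
    have := Nat.one_le_two_pow (n := m)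
    omega
  · rw [hbb, eq_comm, ← hz, orderOf_pow_of_dvd (by positivity) (hn' ▸ dvd_mul_left _ _), hn',
      Nat.mul_div_cancel _ (by positivity)]
  -- Both `x` and `b` invert `a`, so `b⁻¹ * x` centralizes it.
  · intro x hx
    obtain ⟨hxa, -⟩ := hinv x hx
    refine hcent _ ?_
    have h1 : a * b = b * a⁻¹ := by rw [← hba]; group
    have h2 : a * x = x * a⁻¹ := by rw [← hxa]; group
    have h3 : a⁻¹ * x = x * a := by
      rw [inv_mul_eq_iff_eq_mul, ← mul_assoc, h2, inv_mul_cancel_right]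
    have h4 : b * a = a⁻¹ * b := by
      rw [eq_inv_mul_iff_mul_eq, ← mul_assoc, h1, inv_mul_cancel_right]
    have h5 : a * b⁻¹ = b⁻¹ * a⁻¹ := by
      rw [mul_inv_eq_iff_eq_mul, mul_assoc, ← h4, inv_mul_cancel_left]
    change b⁻¹ * x * a = a * (b⁻¹ * x)
    rw [mul_assoc, ← h3, ← mul_assoc, ← mul_assoc, h5]

end TwoGroup

/-! ### Involutions of cyclic and quaternion groups, and the equivalence -/

theorem IsCyclic.existsUnique_orderOf_eq_two {G : Type*} [Group G] [Finite G] [IsCyclic G]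
    (h : 2 ∣ Nat.card G) : ∃! x : G, orderOf x = 2 := by
  classical
  have := Fintype.ofFinite G
  rw [Nat.card_eq_fintype_card] at h
  have hcard := IsCyclic.card_orderOf_eq_totient h
  rw [Nat.totient_two, Finset.card_eq_one] at hcard
  obtain ⟨x, hx⟩ := hcard
  have hmem (y : G) : orderOf y = 2 ↔ y = x := by
    simpa using congrArg (y ∈ ·) hx
  exact ⟨x, (hmem x).2 rfl, fun y hy => (hmem y).1 hy⟩

/-- The elements `xa i` have order 4, and `2i ≡ 0` modulo `2n` with `i ≠ 0` leaves only `i = n`. -/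
theorem QuaternionGroup.existsUnique_orderOf_eq_two (n : ℕ) [NeZero n] :
    ∃! x : QuaternionGroup n, orderOf x = 2 := by
  have : Fact (Nat.Prime 2) := ⟨Nat.prime_two⟩
  refine ⟨.a n, ?_, ?_⟩
  · beta_reduce
    rw [← QuaternionGroup.a_one_pow, orderOf_pow_of_dvd (NeZero.ne n) (by simp),
      QuaternionGroup.orderOf_a_one, Nat.mul_div_cancel _ (NeZero.pos n)]
  · rintro (i | i) hi
    · rw [orderOf_eq_prime_iff, pow_two, QuaternionGroup.a_mul_a, QuaternionGroup.one_def] at hi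
      obtain ⟨h1, h2⟩ := hi
      have h1 : ((i.val + i.val : ℕ) : ZMod (2 * n)) = 0 := by
        push_cast
        rw [ZMod.natCast_zmod_val]
        exact QuaternionGroup.a.inj h1
      rw [ZMod.natCast_eq_zero_iff, ← two_mul, Nat.mul_dvd_mul_iff_left two_pos] at h1
      obtain ⟨c, hc⟩ := h1
      have hlt := ZMod.val_lt i
      have hc2 : c < 2 := by
        by_contra! h
        have := Nat.mul_le_mul_left n h
        omega
      have hi0 : i.val ≠ 0 := fun h => h2 (by rw [(ZMod.val_eq_zero i).1 h])
      have : i.val = n := by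
        interval_cases c <;> omega
      rw [← ZMod.natCast_zmod_val i, this]
    · rw [QuaternionGroup.orderOf_xa] at hi
      omega

theorem theorem1p3 {G : Type*} [Group G] [Finite G]
    (h_gt : 1 < Nat.card G) (h_not_prime : ¬ (Nat.card G).Prime) :
    List.TFAE [
      ∀ H : Subgroup G, H ≠ ⊥ → H ≠ ⊤ → ¬ IsGroupPerfectCode (H : Set G),
      IsPGroup 2 G ∧ ∃! x : G, orderOf x = 2,
      (IsPGroup 2 G ∧ IsCyclic G) ∨ (IsPGroup 2 G ∧ IsGeneralizedQuaternion G)] := by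
  have : Fact (Nat.Prime 2) := ⟨Nat.prime_two⟩
  tfae_have 1 → 2 := isPGroup_two_and_existsUnique_involution h_gt h_not_prime
  tfae_have 2 → 1 := fun h H h_bot h_top => h.1.not_isGroupPerfectCode h.2 h_bot h_top
  tfae_have 2 → 3 := fun h => (isCyclic_or_isGeneralizedQuaternion h.1 h.2).imp
    (fun h' => ⟨h.1, h'⟩) (fun h' => ⟨h.1, h'⟩)
  tfae_have 3 → 2 := by
    rintro (⟨hG, hcyc⟩ | ⟨hG, n, hn, ⟨e⟩⟩)
    · exact ⟨hG, IsCyclic.existsUnique_orderOf_eq_two (hG.card_eq_or_dvd.resolve_left h_gt.ne')⟩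
    · have : NeZero n := ⟨by omega⟩
      obtain ⟨x, hx, huniq⟩ := QuaternionGroup.existsUnique_orderOf_eq_two n
      refine ⟨hG, e.symm x, (MulEquiv.orderOf_eq e.symm x).trans hx, fun y hy => ?_⟩
      rw [MulEquiv.eq_symm_apply]
      exact huniq _ ((MulEquiv.orderOf_eq e y).trans hy)
  tfae_finish
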